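/- Let $X$ be a set and let $\mathcal{A}$ be a field of subsets of $X$ (a family of subsets of $X$ containing $\emptyset$ and closed under finite unions and complements). Let $\mathcal{M}(X,\mathcal{A})$ be the set of all functions $f\colon X\to\mathbb{R}$ such that $f^{-1}(U)\in\mathcal{A}$ for every open $U\subseteq\mathbb{R}$, with pointwise addition and multiplication. Say that $X$ has non-measurable cardinal if every proper prime order ideal $P$ of the power set $\mathcal{P}(X)$ that is closed under countable unions has the form $P=\{A\subseteq X : x\notin A\}$ for some $x\in X$ (equivalently, every ultrafilter on $X$ closed under countable intersections is principal). A commutative ring $R$ is self-injective if every $R$-module homomorphism from an ideal of $R$ to $R$ extends to an $R$-module homomorphism $R\to R$. Suppose that $X$ has non-measurable cardinal. Then $\mathcal{M}(X,\mathcal{A})$ is a self-injective ring (that is, it is a subring of $\mathbb{R}^X$, and this ring is self-injective) if and only if $\mathcal{A}$ is closed under arbitrary unions. In particular, if $\mathcal{A}$ is a $\sigma$-field, in which case $\mathcal{M}(X,\mathcal{A})$ is always a ring, then self-injectivity of $\mathcal{M}(X,\mathcal{A})$ implies that $\mathcal{A}$ is closed under arbitrary unions. -/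

import Mathlib

/-- `X` has a non-measurable cardinal: every proper prime order ideal of the power set of `X` that
is closed under countable unions is `{A | x ∉ A}` for some point `x`. -/
def HasNonmeasurableCardinal (X : Type*) : Prop :=
  ∀ I : Order.Ideal (Set X), I.IsPrime →
    (∀ s : ℕ → Set X, (∀ n, s n ∈ I) → (⋃ n, s n) ∈ I) →
    ∃ x : X, ∀ A : Set X, A ∈ I ↔ x ∉ A

/-- The set `M(X, 𝒜)` of the functions `f : X → ℝ` such that `f⁻¹(U) ∈ 𝒜` for every open `U`. -/
def measurableFunctions {X : Type*} (𝒜 : Set (Set X)) : Set (X → ℝ) :=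
  {f | ∀ U : Set ℝ, IsOpen U → f ⁻¹' U ∈ 𝒜}

/-- A commutative ring `R` is self-injective if every `R`-module homomorphism from an ideal of `R`
to `R` extends to an `R`-module homomorphism `R → R`. -/
def IsSelfInjective (R : Type*) [CommRing R] : Prop :=
  ∀ (I : Ideal R) (φ : I →ₗ[R] R), ∃ Φ : R →ₗ[R] R, ∀ x : I, Φ x = φ x

/-- `M(X, 𝒜)` is a self-injective ring: it is (the underlying set of) a subring of `ℝ^X`, with the
pointwise operations, and this ring is self-injective. For a field of sets `𝒜` that is not a
σ-field, the set `M(X, 𝒜)` need not be closed under addition. -/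
def MeasurableFunctionsSelfInjective {X : Type*} (𝒜 : Set (Set X)) : Prop :=
  ∃ S : Subring (X → ℝ), (S : Set (X → ℝ)) = measurableFunctions 𝒜 ∧ IsSelfInjective S

open MeasureTheory Set

section Measurable

variable {X : Type*} {𝒜 : Set (Set X)}

/-! If `𝒜` is closed under unions, its atoms partition `X`, and the ring consists of the functions
constant on atoms, a product of copies of `ℝ`; module maps from ideals are multiplications by
pointwise quotients.

Conversely, self-injectivity allows arbitrary constants to be prescribed on a disjoint family in `𝒜`
(`exists_measurable_extension`). Take a maximal disjoint family adapted to `𝒮`. Evaluating such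
extensions at a point `p` yields a countably complete ultrafilter; it is principal, which forces `p`
into a member (`sUnion_eq_univ_of_dense`). So the family covers `X`, and a 0-1 valued extension has
`⋃₀ 𝒮` as a preimage of an open set. -/

theorem indicator_const_mem_measurableFunctions (h𝒜 : IsSetAlgebra 𝒜) {D : Set X} (hD : D ∈ 𝒜)
    (c : ℝ) : D.indicator (fun _ ↦ c) ∈ measurableFunctions 𝒜 := by
  classical
  intro U _
  rcases indicator_const_preimage D U c with h | h | h | h <;> rw [h]
  exacts [h𝒜.univ_mem, hD, h𝒜.compl_mem hD, h𝒜.empty_mem]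

end Measurable

/-! ### Fields of sets closed under arbitrary unions -/

section CompleteField

variable {X : Type*} {𝒜 : Set (Set X)}

/-- The intersection of all members of `𝒜` that contain `x`. -/
def atomAt (𝒜 : Set (Set X)) (x : X) : Set X := ⋂₀ {A | A ∈ 𝒜 ∧ x ∈ A}

theorem mem_atomAt_self (x : X) : x ∈ atomAt 𝒜 x := fun _ hA ↦ hA.2

theorem atomAt_mem (h𝒜 : IsSetAlgebra 𝒜) (hU : ∀ 𝒮 : Set (Set X), 𝒮 ⊆ 𝒜 → ⋃₀ 𝒮 ∈ 𝒜) (x : X) :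
    atomAt 𝒜 x ∈ 𝒜 := by
  rw [atomAt, sInter_eq_compl_sUnion_compl]
  refine h𝒜.compl_mem (hU _ ?_)
  rintro _ ⟨A, hA, rfl⟩
  exact h𝒜.compl_mem hA.1

theorem eq_of_mem_atomAt {f : X → ℝ} (hf : f ∈ measurableFunctions 𝒜) {x y : X}
    (hy : y ∈ atomAt 𝒜 x) : f y = f x := by
  by_contra hne
  exact hy (f ⁻¹' {f y}ᶜ) ⟨hf _ isOpen_compl_singleton, fun h ↦ hne h.symm⟩ rfl

theorem mem_measurableFunctions_iff (h𝒜 : IsSetAlgebra 𝒜)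
    (hU : ∀ 𝒮 : Set (Set X), 𝒮 ⊆ 𝒜 → ⋃₀ 𝒮 ∈ 𝒜) {f : X → ℝ} :
    f ∈ measurableFunctions 𝒜 ↔ ∀ x, ∀ y ∈ atomAt 𝒜 x, f y = f x := by
  refine ⟨fun hf x y hy ↦ eq_of_mem_atomAt hf hy, fun h U _ ↦ ?_⟩
  have : f ⁻¹' U = ⋃₀ (atomAt 𝒜 '' (f ⁻¹' U)) := by
    ext y
    simp only [mem_sUnion, mem_image, exists_exists_and_eq_and]
    refine ⟨fun hy ↦ ⟨y, hy, mem_atomAt_self y⟩, ?_⟩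
    rintro ⟨x, hx, hy⟩
    rwa [mem_preimage, h x y hy]
  rw [this]
  refine hU _ ?_
  rintro _ ⟨x, -, rfl⟩
  exact atomAt_mem h𝒜 hU x

/-- The functions that are constant on the sets `atomAt 𝒜 x`. -/
def atomConstantSubring (𝒜 : Set (Set X)) : Subring (X → ℝ) where
  carrier := {f | ∀ x, ∀ y ∈ atomAt 𝒜 x, f y = f x}
  mul_mem' hf hg x y hy := by simp only [Pi.mul_apply, hf x y hy, hg x y hy]
  one_mem' _ _ _ := rfl
  add_mem' hf hg x y hy := by simp only [Pi.add_apply, hf x y hy, hg x y hy]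
  zero_mem' _ _ _ := rfl
  neg_mem' hf x y hy := by simp only [Pi.neg_apply, hf x y hy]

theorem isSelfInjective_atomConstantSubring : IsSelfInjective (atomConstantSubring 𝒜) := by
  classical
  intro I φ
  have hcross (f g : I) (x : X) :
      (f : atomConstantSubring 𝒜).1 x * (φ g).1 x = (g : atomConstantSubring 𝒜).1 x * (φ f).1 x := by
    have h : (f : atomConstantSubring 𝒜) • φ g = (g : atomConstantSubring 𝒜) • φ f := by
      rw [← map_smul, ← map_smul]
      congr 1
      ext1
      exact mul_comm _ _
    exact congrFun (congrArg Subtype.val h) x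
  have hvanish (f : I) (x : X) (hx : (f : atomConstantSubring 𝒜).1 x = 0) : (φ f).1 x = 0 := by
    -- Since `0⁻¹ = 0`, this is the indicator of the support of `f`.
    let e : atomConstantSubring 𝒜 :=
      ⟨fun x ↦ (f : atomConstantSubring 𝒜).1 x * ((f : atomConstantSubring 𝒜).1 x)⁻¹,
        fun x y hy ↦ by simp only [f.1.2 x y hy]⟩
    have h : f = e • f := by
      ext x
      exact (mul_inv_mul_cancel _).symm
    rw [h, map_smul]
    change (f : atomConstantSubring 𝒜).1 x * _ * _ = 0
    rw [hx, zero_mul, zero_mul]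
  -- By `hcross` the quotient does not depend on the chosen `f`. Where all of `I` vanishes, `φ`
  -- imposes no condition.
  let u : X → ℝ := fun x ↦
    if h : ∃ f : I, (f : atomConstantSubring 𝒜).1 x ≠ 0 then
      (φ h.choose).1 x / (h.choose : atomConstantSubring 𝒜).1 x else 0
  have hu (f : I) (x : X) : u x * (f : atomConstantSubring 𝒜).1 x = (φ f).1 x := by
    by_cases hx : (f : atomConstantSubring 𝒜).1 x = 0
    · rw [hx, hvanish f x hx, mul_zero]
    · have h : ∃ f : I, (f : atomConstantSubring 𝒜).1 x ≠ 0 := ⟨f, hx⟩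
      simp only [u, dif_pos h]
      rw [div_mul_eq_mul_div, div_eq_iff h.choose_spec, mul_comm, hcross f h.choose x, mul_comm]
  have humem : u ∈ atomConstantSubring 𝒜 := by
    intro x y hy
    by_cases h : ∃ f : I, (f : atomConstantSubring 𝒜).1 x ≠ 0
    · obtain ⟨f, hf⟩ := h
      have h₁ := hu f x
      have h₂ := hu f y
      rw [f.1.2 x y hy, (φ f).2 x y hy, ← h₁] at h₂
      exact mul_right_cancel₀ hf h₂
    · have h' : ¬ ∃ f : I, (f : atomConstantSubring 𝒜).1 y ≠ 0 := by
        rintro ⟨f, hf⟩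
        exact h ⟨f, by rwa [← f.1.2 x y hy]⟩
      simp only [u, dif_neg h, dif_neg h']
  refine ⟨LinearMap.mulLeft _ ⟨u, humem⟩, fun f ↦ ?_⟩
  ext x
  exact hu f x

theorem measurableFunctionsSelfInjective_of_sUnion_mem (h𝒜 : IsSetAlgebra 𝒜)
    (hU : ∀ 𝒮 : Set (Set X), 𝒮 ⊆ 𝒜 → ⋃₀ 𝒮 ∈ 𝒜) : MeasurableFunctionsSelfInjective 𝒜 :=
  ⟨atomConstantSubring 𝒜, ext fun _ ↦ (mem_measurableFunctions_iff h𝒜 hU).symm,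
    isSelfInjective_atomConstantSubring⟩

end CompleteField

/-! ### Prescribed constants and the ultrafilter at a point -/

section Extension

variable {X : Type*} {𝒜 : Set (Set X)}

/-- Over a self-injective ring of measurable functions, prescribed constant values on the members
of a disjoint family are attained by a measurable function. -/
theorem exists_measurable_extension (h𝒜 : IsSetAlgebra 𝒜)
    (hM : MeasurableFunctionsSelfInjective 𝒜) {𝒟 : Set (Set X)} (h𝒟 : 𝒟 ⊆ 𝒜)
    (hdisj : 𝒟.PairwiseDisjoint id) (r : Set X → ℝ) :
    ∃ u ∈ measurableFunctions 𝒜, ∀ D ∈ 𝒟, ∀ x ∈ D, u x = r D := by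
  classical
  obtain ⟨S, hS, hinj⟩ := hM
  have hmem (f : X → ℝ) : f ∈ S ↔ f ∈ measurableFunctions 𝒜 := by rw [← hS]; rfl
  let R : X → ℝ := fun x ↦ if h : ∃ D ∈ 𝒟, x ∈ D then r h.choose else 0
  have hR {D} (hD : D ∈ 𝒟) {x} (hx : x ∈ D) : R x = r D := by
    have h : ∃ D ∈ 𝒟, x ∈ D := ⟨D, hD, hx⟩
    simp only [R, dif_pos h]
    rw [hdisj.elim_set h.choose_spec.1 hD x h.choose_spec.2 hx]
  -- `R` need not be measurable, but on functions supported in finitely many members it acts as a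
  -- finite sum of scaled indicators.
  let I : Ideal S :=
    { carrier := {f | ∃ F : Finset (Set X), ↑F ⊆ 𝒟 ∧ ∀ x, f.1 x ≠ 0 → ∃ D ∈ F, x ∈ D}
      zero_mem' := ⟨∅, by simp, fun x hx ↦ (hx rfl).elim⟩
      add_mem' := by
        rintro f g ⟨F, hF, hf⟩ ⟨G, hG, hg⟩
        refine ⟨F ∪ G, by simp [hF, hG], fun x hx ↦ ?_⟩
        by_cases h : f.1 x = 0
        · obtain ⟨D, hD, hxD⟩ := hg x fun h' ↦ hx (by
            change f.1 x + g.1 x = 0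
            rw [h, h', add_zero])
          exact ⟨D, Finset.mem_union_right _ hD, hxD⟩
        · obtain ⟨D, hD, hxD⟩ := hf x h
          exact ⟨D, Finset.mem_union_left _ hD, hxD⟩
      smul_mem' := by
        rintro c f ⟨F, hF, hf⟩
        exact ⟨F, hF, fun x hx ↦ hf x (right_ne_zero_of_mul hx)⟩ }
  have hmul (f : I) : R * f.1.1 ∈ S := by
    obtain ⟨f, F, hF, hf⟩ := f
    have h : R * f.1 = (∑ D ∈ F, D.indicator fun _ ↦ r D) * f.1 := by
      ext x
      simp only [Pi.mul_apply, Finset.sum_apply]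
      by_cases hx : f.1 x = 0
      · rw [hx, mul_zero, mul_zero]
      · obtain ⟨D, hD, hxD⟩ := hf x hx
        rw [Finset.sum_eq_single_of_mem D hD, indicator_of_mem hxD, hR (hF hD) hxD]
        intro E hE hne
        exact indicator_of_notMem
          (fun hxE ↦ hne (hdisj.elim_set (hF hE) (hF hD) x hxE hxD)) _
    rw [h]
    refine S.mul_mem (S.sum_mem fun D hD ↦ (hmem _).2 ?_) f.2
    exact indicator_const_mem_measurableFunctions h𝒜 (h𝒟 (hF hD)) _
  let φ : I →ₗ[S] S :=
    { toFun := fun f ↦ ⟨R * f.1.1, hmul f⟩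
      map_add' := fun f g ↦ Subtype.ext (mul_add R f.1.1 g.1.1)
      map_smul' := fun c f ↦ Subtype.ext (mul_left_comm R c.1 f.1.1) }
  obtain ⟨Φ, hΦ⟩ := hinj I φ
  refine ⟨(Φ 1).1, (hmem _).1 (Φ 1).2, fun D hD x hx ↦ ?_⟩
  let e : S := ⟨D.indicator fun _ ↦ 1,
    (hmem _).2 (indicator_const_mem_measurableFunctions h𝒜 (h𝒟 hD) 1)⟩
  have he : e ∈ I := by
    refine ⟨{D}, by simpa using hD, fun y hy ↦ ⟨D, Finset.mem_singleton_self D, ?_⟩⟩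
    exact mem_of_indicator_ne_zero (f := fun _ ↦ (1 : ℝ)) hy
  have hex : e.1 x = 1 := indicator_of_mem hx fun _ ↦ (1 : ℝ)
  have h₁ : Φ e = e • Φ 1 := by rw [← map_smul, smul_eq_mul, mul_one]
  have h₂ := congrFun (congrArg Subtype.val (h₁.symm.trans (hΦ ⟨e, he⟩))) x
  change e.1 x * (Φ 1).1 x = R x * e.1 x at h₂
  rwa [hex, one_mul, mul_one, hR hD hx] at h₂

/-- If `X` has nonmeasurable cardinal, `M(X, 𝒜)` is self-injective, and `𝒟` is a disjoint family
in `𝒜` that meets every nonempty member of `𝒜`, then `𝒟` covers `X`. -/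
theorem sUnion_eq_univ_of_dense (hX : HasNonmeasurableCardinal X) (h𝒜 : IsSetAlgebra 𝒜)
    (hM : MeasurableFunctionsSelfInjective 𝒜) {𝒟 : Set (Set X)} (h𝒟 : 𝒟 ⊆ 𝒜)
    (hne : ∀ D ∈ 𝒟, D.Nonempty) (hdisj : 𝒟.PairwiseDisjoint id)
    (hdense : ∀ B ∈ 𝒜, B.Nonempty → ∃ D ∈ 𝒟, (B ∩ D).Nonempty) : ⋃₀ 𝒟 = univ := by
  classical
  refine eq_univ_of_forall fun p ↦ ?_
  choose E hEmem hE using exists_measurable_extension h𝒜 hM h𝒟 hdisj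
  have : Nonempty X := ⟨p⟩
  choose! c hc using hne
  -- Density transfers open conditions at `p` to some member of `𝒟`. This replaces any algebraic
  -- relation between the chosen extensions.
  have key₁ {B : Set X} (hB : B ∈ 𝒜) (hpB : p ∈ B) (r : Set X → ℝ) {U : Set ℝ} (hU : IsOpen U)
      (hrU : E r p ∈ U) : ∃ D ∈ 𝒟, r D ∈ U ∧ (B ∩ D).Nonempty := by
    obtain ⟨D, hD, x, ⟨hxB, hxU⟩, hxD⟩ :=
      hdense _ (h𝒜.inter_mem hB (hEmem r U hU)) ⟨p, hpB, hrU⟩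
    exact ⟨D, hD, hE r D hD x hxD ▸ hxU, x, hxB, hxD⟩
  have key {r s : Set X → ℝ} {U V : Set ℝ} (hU : IsOpen U) (hV : IsOpen V)
      (hrU : E r p ∈ U) (hsV : E s p ∈ V) : ∃ D ∈ 𝒟, r D ∈ U ∧ s D ∈ V := by
    obtain ⟨D, hD, hDU, x, hxV, hxD⟩ := key₁ (hEmem s V hV) hsV r hU hrU
    exact ⟨D, hD, hDU, hE s D hD x hxD ▸ hxV⟩
  have hclosed {r : Set X → ℝ} {C : Set ℝ} (hC : IsClosed C) (hr : ∀ D ∈ 𝒟, r D ∈ C) :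
      E r p ∈ C := by
    by_contra h
    obtain ⟨D, hD, h₁, -⟩ := key hC.isOpen_compl hC.isOpen_compl h h
    exact h₁ (hr D hD)
  let χ : Set X → Set X → ℝ := fun A D ↦ if c D ∈ A then 1 else 0
  have hχ (A : Set X) : E (χ A) p = 0 ∨ E (χ A) p = 1 := by
    have : E (χ A) p ∈ ({0, 1} : Set ℝ) := hclosed (toFinite _).isClosed fun D _ ↦ by
      by_cases h : c D ∈ A <;> simp [χ, h]
    simpa using this
  have hpos {A D} (h : χ A D ∈ Ioi (1 / 2 : ℝ)) : c D ∈ A := by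
    by_contra h'
    simp only [χ, if_neg h', mem_Ioi] at h
    norm_num at h
  have hneg {A D} (h : χ A D ∈ Iio (1 / 2 : ℝ)) : c D ∉ A := by
    intro h'
    simp only [χ, if_pos h', mem_Iio] at h
    norm_num at h
  have hone {A} (h : E (χ A) p ≠ 0) : E (χ A) p ∈ Ioi (1 / 2 : ℝ) := by
    rw [(hχ A).resolve_left h, mem_Ioi]
    norm_num
  have hzero {A} (h : E (χ A) p = 0) : E (χ A) p ∈ Iio (1 / 2 : ℝ) := by
    rw [h, mem_Iio]
    norm_num
  have hmono {A B : Set X} (hAB : A ⊆ B) (hB : E (χ B) p = 0) : E (χ A) p = 0 := by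
    by_contra h
    obtain ⟨D, -, h₁, h₂⟩ := key isOpen_Ioi isOpen_Iio (hone h) (hzero hB)
    exact hneg h₂ (hAB (hpos h₁))
  have hiUnion (s : ℕ → Set X) (hs : ∀ n, E (χ (s n)) p = 0) : E (χ (⋃ n, s n)) p = 0 := by
    by_contra h
    -- One plus the least index, with `0` reserved for points outside the union. The value at `p` is
    -- again a natural number: `0` contradicts `h`, and `n + 1` contradicts `hs n`.
    let r : Set X → ℝ := fun D ↦
      if hD : ∃ n, c D ∈ s n then ((Nat.find hD + 1 : ℕ) : ℝ) else 0
    have hr : E r p ∈ range ((↑) : ℕ → ℝ) := by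
      refine hclosed Nat.isClosedEmbedding_coe_real.isClosed_range fun D _ ↦ ?_
      by_cases hD : ∃ n, c D ∈ s n
      · exact ⟨Nat.find hD + 1, by simp only [r, dif_pos hD]⟩
      · exact ⟨0, by simp only [r, dif_neg hD, Nat.cast_zero]⟩
    obtain ⟨m, hm⟩ := hr
    have hball {n : ℕ} (hD : (n : ℝ) ∈ Metric.ball (m : ℝ) 1) : n = m := by
      rw [Metric.mem_ball, Real.dist_eq] at hD
      have : |(n : ℤ) - m| < 1 := by exact_mod_cast hD
      exact_mod_cast sub_eq_zero.1 (Int.abs_lt_one_iff.1 this)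
    have hrm : E r p ∈ Metric.ball (m : ℝ) 1 := hm ▸ Metric.mem_ball_self one_pos
    rcases m with _ | n
    · obtain ⟨D, -, h₁, h₂⟩ := key Metric.isOpen_ball isOpen_Ioi hrm (hone h)
      have hD : ∃ n, c D ∈ s n := mem_iUnion.1 (hpos h₂)
      simp only [r, dif_pos hD] at h₁
      exact absurd (hball h₁) (Nat.succ_ne_zero _)
    · obtain ⟨D, -, h₁, h₂⟩ := key Metric.isOpen_ball isOpen_Iio hrm (hzero (hs n))
      by_cases hD : ∃ n, c D ∈ s n
      · simp only [r, dif_pos hD] at h₁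
        exact hneg h₂ (Nat.succ_injective (hball h₁) ▸ Nat.find_spec hD)
      · simp only [r, dif_neg hD] at h₁
        rw [← Nat.cast_zero] at h₁
        exact absurd (hball h₁) (Nat.succ_ne_zero _).symm
  let I : Order.Ideal (Set X) :=
    { carrier := {A | E (χ A) p = 0}
      lower' := fun B A hAB hB ↦ hmono hAB hB
      nonempty' := by
        refine ⟨∅, ?_⟩
        by_contra h
        obtain ⟨D, -, h₁, -⟩ := key isOpen_Ioi isOpen_Ioi (hone h) (hone h)
        exact hpos h₁
      directed' := by
        intro A hA B hB
        refine ⟨A ∪ B, ?_, subset_union_left, subset_union_right⟩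
        have := hiUnion (fun n ↦ if n = 0 then A else B) fun n ↦ by
          by_cases hn : n = 0
          · simpa only [if_pos hn] using (show E (χ A) p = 0 from hA)
          · simpa only [if_neg hn] using (show E (χ B) p = 0 from hB)
        refine hmono (union_subset ?_ ?_) this
        · exact subset_iUnion_of_subset 0 (by simp)
        · exact subset_iUnion_of_subset 1 (by simp) }
  have hI (A : Set X) : A ∈ I ↔ E (χ A) p = 0 := Iff.rfl
  have hproper : I.IsProper := by
    refine Order.Ideal.isProper_of_notMem (p := univ) fun h ↦ ?_
    obtain ⟨D, -, h₁, -⟩ := key isOpen_Iio isOpen_Iio (hzero h) (hzero h)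
    exact hneg h₁ (mem_univ _)
  have hprime : I.IsPrime := by
    refine Order.Ideal.isPrime_of_mem_or_compl_mem fun {A} ↦ ?_
    by_contra! h
    obtain ⟨D, -, h₁, h₂⟩ := key isOpen_Ioi isOpen_Ioi (hone h.1) (hone h.2)
    exact hpos h₂ (hpos h₁)
  obtain ⟨x, hx⟩ := hX I hprime hiUnion
  -- The ultrafilter concentrates on a single `D` with `c D = x`. If `p ∉ D`, density inside `Dᶜ`
  -- gives a member with the same chosen point, hence `D` itself.
  have hxI : E (χ {x}) p ∈ Ioi (1 / 2 : ℝ) := hone fun h ↦ (hx {x}).1 h rfl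
  obtain ⟨D, hD, h₁, -⟩ := key isOpen_Ioi isOpen_Ioi hxI hxI
  refine ⟨D, hD, ?_⟩
  by_contra hpD
  obtain ⟨D', hD', h₂, y, hyD, hyD'⟩ := key₁ (h𝒜.compl_mem (h𝒟 hD)) hpD _ isOpen_Ioi hxI
  have hcc : c D = c D' := (hpos h₁).trans (hpos h₂).symm
  have : D' = D := hdisj.elim_set hD' hD (c D') (hc D' hD') (hcc ▸ hc D hD)
  exact hyD (this ▸ hyD')

end Extension

/-! ### Maximal disjoint families -/

section MaximalDisjoint

variable {X : Type*} {𝒜 : Set (Set X)}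

/-- There is a disjoint family in `𝒜`, meeting every nonempty member of `𝒜`, each of whose members
is contained in a member of `𝒮` or disjoint from all of them. -/
theorem exists_dense_disjoint_family (h𝒜 : IsSetAlgebra 𝒜) {𝒮 : Set (Set X)} (h𝒮 : 𝒮 ⊆ 𝒜) :
    ∃ 𝒟 ⊆ 𝒜, (∀ D ∈ 𝒟, D.Nonempty) ∧ 𝒟.PairwiseDisjoint id ∧
      (∀ B ∈ 𝒜, B.Nonempty → ∃ D ∈ 𝒟, (B ∩ D).Nonempty) ∧
      ∀ D ∈ 𝒟, (∃ A ∈ 𝒮, D ⊆ A) ∨ Disjoint D (⋃₀ 𝒮) := by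
  let 𝒢 : Set (Set X) :=
    {D | D ∈ 𝒜 ∧ D.Nonempty ∧ ((∃ A ∈ 𝒮, D ⊆ A) ∨ Disjoint D (⋃₀ 𝒮))}
  obtain ⟨𝒟, h𝒟⟩ := zorn_subset {𝒟 : Set (Set X) | 𝒟 ⊆ 𝒢 ∧ 𝒟.PairwiseDisjoint id} fun C hC hch ↦
    ⟨⋃₀ C, ⟨sUnion_subset fun 𝒟 h ↦ (hC h).1,
      (pairwiseDisjoint_sUnion hch.directedOn).2 fun 𝒟 h ↦ (hC h).2⟩,
      fun _ ↦ subset_sUnion_of_mem⟩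
  have hmeet (G) (hG : G ∈ 𝒢) : ∃ D ∈ 𝒟, (G ∩ D).Nonempty := by
    by_contra! h
    have hins : insert G 𝒟 ∈ {𝒟 : Set (Set X) | 𝒟 ⊆ 𝒢 ∧ 𝒟.PairwiseDisjoint id} :=
      ⟨insert_subset hG h𝒟.prop.1,
        h𝒟.prop.2.insert fun D hD _ ↦ disjoint_iff_inter_eq_empty.2 (h D hD)⟩
    have hGD : G ∈ 𝒟 := h𝒟.le_of_ge hins (subset_insert _ _) (mem_insert _ _)
    have := h G hGD
    rw [inter_self] at this
    exact hG.2.1.ne_empty this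
  refine ⟨𝒟, fun D hD ↦ (h𝒟.prop.1 hD).1, fun D hD ↦ (h𝒟.prop.1 hD).2.1, h𝒟.prop.2,
    fun B hB hBne ↦ ?_, fun D hD ↦ (h𝒟.prop.1 hD).2.2⟩
  -- Either some `B ∩ A` or `B` itself lies in `𝒢`, so maximality applies.
  by_cases h : ∃ A ∈ 𝒮, (B ∩ A).Nonempty
  · obtain ⟨A, hA, hBA⟩ := h
    obtain ⟨D, hD, hBD⟩ := hmeet (B ∩ A)
      ⟨h𝒜.inter_mem hB (h𝒮 hA), hBA, Or.inl ⟨A, hA, inter_subset_right⟩⟩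
    exact ⟨D, hD, hBD.mono (inter_subset_inter_left _ inter_subset_left)⟩
  · push Not at h
    exact hmeet B ⟨hB, hBne, Or.inr (disjoint_sUnion_right.2 fun A hA ↦
      disjoint_iff_inter_eq_empty.2 (h A hA))⟩

end MaximalDisjoint

theorem sUnion_mem_of_measurableFunctionsSelfInjective {X : Type*}
    (hX : HasNonmeasurableCardinal X) {𝒜 : Set (Set X)} (h𝒜 : IsSetAlgebra 𝒜)
    (hM : MeasurableFunctionsSelfInjective 𝒜) {𝒮 : Set (Set X)} (h𝒮 : 𝒮 ⊆ 𝒜) : ⋃₀ 𝒮 ∈ 𝒜 := by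
  classical
  obtain ⟨𝒟, h𝒟, hne, hdisj, hdense, hsub⟩ := exists_dense_disjoint_family h𝒜 h𝒮
  have hcover := sUnion_eq_univ_of_dense hX h𝒜 hM h𝒟 hne hdisj hdense
  obtain ⟨u, hu, hur⟩ := exists_measurable_extension h𝒜 hM h𝒟 hdisj
    fun D ↦ if ∃ A ∈ 𝒮, D ⊆ A then 1 else 0
  convert hu (Ioi 0) isOpen_Ioi
  ext x
  obtain ⟨D, hD, hxD⟩ := hcover.symm ▸ mem_univ x
  rw [mem_preimage, hur D hD x hxD]
  by_cases h : ∃ A ∈ 𝒮, D ⊆ A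
  · obtain ⟨A, hA, hDA⟩ := h
    simpa only [if_pos (⟨A, hA, hDA⟩ : ∃ A ∈ 𝒮, D ⊆ A), mem_Ioi, zero_lt_one, iff_true] using
      mem_sUnion_of_mem (hDA hxD) hA
  · simpa only [if_neg h, mem_Ioi, lt_irrefl, iff_false] using
      disjoint_left.1 ((hsub D hD).resolve_left h) hxD

theorem theorem3p16 {X : Type*} (hX : HasNonmeasurableCardinal X)
    (𝒜 : Set (Set X)) (h𝒜 : MeasureTheory.IsSetAlgebra 𝒜) :
    MeasurableFunctionsSelfInjective 𝒜 ↔ ∀ 𝒮 : Set (Set X), 𝒮 ⊆ 𝒜 → ⋃₀ 𝒮 ∈ 𝒜 :=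
  ⟨fun hM _ h𝒮 ↦ sUnion_mem_of_measurableFunctionsSelfInjective hX h𝒜 hM h𝒮,
    measurableFunctionsSelfInjective_of_sUnion_mem h𝒜⟩
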